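/- Let $n\ge 0$. A *standard word* of length $n$ is a word in which each of $1,\dots,n$ occurs exactly once, and $P(w)$ denotes the Schensted (row) insertion tableau of the word $w$, in English notation. *Corotations.* The cocharge labeling of a standard word $w$ labels the letter $1$ by $0$ and, if the letter $i$ is labeled $k$, labels the letter $i+1$ by $k$ if $i+1$ appears to the right of $i$ in $w$ and by $k+1$ if it appears to the left. If $u=wa$ is a standard word with last letter $a\neq 1$, then $v=aw$ is the corotation of $u$; it is a *non-zero* corotation of $u$ if the label of $a$ in the cocharge labeling of $u$ is positive, and a *zero* corotation of $u$ if that label is $0$. *Catabolizability.* The row reading word of a tableau reads its rows from left to right, starting with the bottom row. For a tableau $T$ with distinct entries whose first row has at least $m$ entries, the $m$-catabolism $\mathrm{Cat}_m(T)$ is $P(xy)$, where $x$ is the first row of $T$ without its first $m$ entries and $y$ is the row reading word of the tableau formed by the remaining rows of $T$. The empty tableau is $\varnothing$-catabolizable; for a nonempty partition $\lambda=(\lambda_1,\widehat\lambda)$ of $|T|$, $T$ is $\lambda$-catabolizable if its first row has at least $\lambda_1$ entries, the first $\lambda_1$ of these are the $\lambda_1$ smallest entries of $T$, and $\mathrm{Cat}_{\lambda_1}(T)$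 is $\widehat\lambda$-catabolizable. For a standard word $w$ of length $n$, $\mathrm{ctype}(w)$ is the unique maximal (in dominance order) partition $\lambda$ of $n$ such that $P(w)$ is $\lambda$-catabolizable. Let $u$ and $v$ be standard words of length $n$. Then $\mathrm{ctype}(u)$ and $\mathrm{ctype}(v)$ are well defined, that is, in each case exactly one such maximal partition exists, and: 1. if $v$ is a non-zero corotation of $u$, then $\mathrm{ctype}(v)=\mathrm{ctype}(u)$; 2. if $v$ is a zero corotation of $u$, then $\mathrm{ctype}(v)$ is strictly smaller than $\mathrm{ctype}(u)$ in dominance order. -/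

import Mathlib

namespace Catabolism

/-! ### Standard words, cocharge labels and corotations -/

/-- A standard word of length `n`: the letters are `1, …, n`, each occurring exactly once. -/
def IsStandardWord (n : ℕ) (w : List ℕ) : Prop :=
  w.Perm (List.range' 1 n)

/-- The label that the letter `i ≥ 1` of the standard word `w` gets in the cocharge labeling of `w`:
the letter `1` is labeled `0`, and if the letter `i` is labeled `k`, then the letter `i + 1` is
labeled `k + 1` if it appears to the left of `i` in `w`, and `k` if it appears to the right.
(There is no letter `0`; its value is irrelevant.) -/
def cochargeLabel (w : List ℕ) : ℕ → ℕ
  | 0 => 0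
  | 1 => 0
  | i + 2 =>
      if w.idxOf (i + 2) < w.idxOf (i + 1) then cochargeLabel w (i + 1) + 1
      else cochargeLabel w (i + 1)

/-- `v` is a non-zero corotation of `u`: `u = wa` and `v = aw` for a word `w` and a letter `a ≠ 1`
whose label in the cocharge labeling of `u = wa` is positive. -/
def IsNonzeroCorotation (v u : List ℕ) : Prop :=
  ∃ (w : List ℕ) (a : ℕ), a ≠ 1 ∧ u = w ++ [a] ∧ v = a :: w ∧ 0 < cochargeLabel u a

/-- `v` is a zero corotation of `u`: `u = wa` and `v = aw` for a word `w` and a letter `a ≠ 1`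
whose label in the cocharge labeling of `u = wa` is zero. -/
def IsZeroCorotation (v u : List ℕ) : Prop :=
  ∃ (w : List ℕ) (a : ℕ), a ≠ 1 ∧ u = w ++ [a] ∧ v = a :: w ∧ cochargeLabel u a = 0

/-! ### Tableaux and Schensted insertion

A tableau is the list of its rows (English notation: from north to south), each row being the
list of its entries from west to east; all listed rows are nonempty. -/

/-- Schensted insertion of `a` into one row: `a` replaces the leftmost entry greater than `a`, and
that entry is returned as the bumped one; if there is none, `a` is put at the end of the row. -/
def rowInsert (a : ℕ) : List ℕ → List ℕ × Option ℕ
  | [] => ([a], none)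
  | b :: r =>
      if a < b then (a :: r, some b)
      else (b :: (rowInsert a r).1, (rowInsert a r).2)

/-- Schensted row insertion of `a` into a tableau: an entry bumped from a row is inserted into the
next row. -/
def tableauInsert : List (List ℕ) → ℕ → List (List ℕ)
  | [], a => [[a]]
  | r :: T, a =>
      match rowInsert a r with
      | (s, none) => s :: T
      | (s, some b) => s :: tableauInsert T b

/-- The insertion tableau `P(w)`. -/
def insertionTableau (w : List ℕ) : List (List ℕ) :=
  w.foldl tableauInsert []

/-- The row reading word: rows are read from west to east, starting with the southernmost row. -/
def rowWord (T : List (List ℕ)) : List ℕ :=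
  T.reverse.flatten

/-- The `m`-catabolism of `T`: remove the first `m` entries of the first row, let `T_n` be what is
left of the first row and `T_s` the tableau formed by the other rows, and insert the word obtained
by putting the row reading word of `T_n` before that of `T_s`. -/
def catabolism (m : ℕ) : List (List ℕ) → List (List ℕ)
  | [] => []
  | r :: T => insertionTableau (r.drop m ++ rowWord T)

/-- `(m) ⊆ sh(T)`, and the first `m` entries of the first row of `T` are the `m` smallest entries
of `T` (for a tableau `T` with distinct entries). -/
def FirstRowSmallest (m : ℕ) : List (List ℕ) → Prop
  | [] => m = 0
  | r :: T => m ≤ r.length ∧ ∀ a ∈ r.take m, ∀ b ∈ r.drop m ++ T.flatten, a < b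

/-- `λ`-catabolizability, with `λ` given as the list of its parts. -/
def CatabolizableList : List ℕ → List (List ℕ) → Prop
  | [], T => T = []
  | m :: l, T => FirstRowSmallest m T ∧ CatabolizableList l (catabolism m T)

/-! ### Partitions, dominance order and catabolizability -/

/-- The parts of a partition in weakly decreasing order. -/
def sortedParts {n : ℕ} (p : n.Partition) : List ℕ :=
  p.parts.sort (· ≥ ·)

/-- `p ⊴ q` in dominance order. -/
def DominanceLE {n : ℕ} (p q : n.Partition) : Prop :=
  ∀ k : ℕ, ((sortedParts p).take k).sum ≤ ((sortedParts q).take k).sum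

/-- `p ◁ q` in dominance order. -/
def DominanceLT {n : ℕ} (p q : n.Partition) : Prop :=
  DominanceLE p q ∧ p ≠ q

/-- `T` is `p`-catabolizable. -/
def Catabolizable {n : ℕ} (p : n.Partition) (T : List (List ℕ)) : Prop :=
  CatabolizableList (sortedParts p) T

/-- `p` is maximal in dominance order among the partitions for which `T` is catabolizable. -/
def IsMaximalCatabolizable {n : ℕ} (T : List (List ℕ)) (p : n.Partition) : Prop :=
  Catabolizable p T ∧ ∀ q : n.Partition, Catabolizable q T → DominanceLE p q → q = p

/-- `p` is the catabolizability of `T`: the unique maximal partition in dominance order such that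
`T` is `p`-catabolizable. -/
def IsCatabolizability {n : ℕ} (T : List (List ℕ)) (p : n.Partition) : Prop :=
  IsMaximalCatabolizable T p ∧ ∀ q : n.Partition, IsMaximalCatabolizable T q → q = p

/-- `ctype(w) = ctype(P(w))`, the catabolizability of the insertion tableau of a word `w` of
length `n` (an arbitrary partition of `n` if `P(w)` had no catabolizability). -/
noncomputable def ctype (n : ℕ) (w : List ℕ) : n.Partition :=
  Classical.epsilon fun p : n.Partition => IsCatabolizability (insertionTableau w) p

end Catabolism

namespace Catabolism

/-! The catabolizability of `P(w)` can be computed without tableaux. Read the cocharge labels of `w`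
from right to left into a queue and process it against `n` columns of height 0. For each threshold
`k`, the number of labels that are not discarded is the sum of the first `k` parts of `ctype(w)`
(`IsCochargeLabeling.ctype_spec`). A corotation takes the first label `c` of the queue and puts `c +
1` at its end. If `c > 0`, no column has height `c`, so the process makes this very move itself and
no overflow changes (`overflow_cons_eq`). If `c = 0`, the overflows can only grow
(`overflow_cons_le`), so the new type is dominated by the old one; it is a different partition
because threshold 1 discards exactly the nonzero labels (`overflow_one`), and there is now one more
of them.

The formula for `ctype` rests on two facts. Knuth moves on a word keep its cocharge labeling and
change the label queue only by local moves, which preserve the overflow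
(`IsCochargeLabeling.overflow_eq_of_knuth`, `overflow_localMove`); hence `w` may be replaced by the
reading word of `P(w)`. In that word, the catabolism by `m` means: send the labels of the rest of
the first row to the end of the queue, raised by one, and insert the `m` lowest labels into columns.
Sending labels to the end never lowers the overflow, so every catabolizing partition gives a bound
(`overflow_add_sum_take_le`). The greedy choice of `m` follows the process exactly and attains all
these bounds at once (`exists_catabolizableList`), so it gives a greatest partition in dominance
order.

The technical core is the monotonicity of the process, proved for columns (`RaiseLE`) and adjacent
labels (`SwapLE`) by a joint induction on `weight`. -/

/-! ### The column-filling process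

A queue of labels is processed from its head, against a multiset `H` of column heights. A label
`c ≥ k` is discarded, a label `c ∈ H` raises a column of height `c` to height `c + 1`, and any other
label `c` goes to the end of the queue as `c + 1`. -/

/-- The number of labels that are discarded when the queue is processed with threshold `k`. -/
def overflow (k : ℕ) (H : Multiset ℕ) (x : List ℕ) : ℕ :=
  match x with
  | [] => 0
  | c :: y =>
      if k ≤ c then overflow k H y + 1
      else if c ∈ H then overflow k ((c + 1) ::ₘ H.erase c) y
      else overflow k H (y ++ [c + 1])
-- Cycling a label `c < k` lowers `k - c` by one; the other branches remove a summand, which is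
-- positive thanks to the `+ 1`.
termination_by (x.map fun c => k - c + 1).sum
decreasing_by
  all_goals simp
  all_goals omega

/-- The termination measure of `overflow`. -/
def weight (k : ℕ) (x : List ℕ) : ℕ := (x.map fun c => k - c + 1).sum

@[simp] lemma weight_nil (k : ℕ) : weight k [] = 0 := rfl

@[simp] lemma weight_cons (k c : ℕ) (x : List ℕ) :
    weight k (c :: x) = k - c + 1 + weight k x := by
  simp [weight]

@[simp] lemma weight_append (k : ℕ) (x y : List ℕ) :
    weight k (x ++ y) = weight k x + weight k y := by
  simp [weight]

@[simp] lemma overflow_nil (k : ℕ) (H : Multiset ℕ) : overflow k H [] = 0 := by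
  rw [overflow]

lemma overflow_discard {k c : ℕ} (h : k ≤ c) (H : Multiset ℕ) (y : List ℕ) :
    overflow k H (c :: y) = overflow k H y + 1 := by
  rw [overflow, if_pos h]

lemma overflow_insert {k c : ℕ} (h : c < k) (H : Multiset ℕ) (y : List ℕ) :
    overflow k (c ::ₘ H) (c :: y) = overflow k ((c + 1) ::ₘ H) y := by
  rw [overflow, if_neg (by omega), if_pos (by simp), Multiset.erase_cons_head]

lemma overflow_cycle {k c : ℕ} (h : c < k) {H : Multiset ℕ} (hc : c ∉ H) (y : List ℕ) :
    overflow k H (c :: y) = overflow k H (y ++ [c + 1]) := by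
  rw [overflow, if_neg (by omega), if_neg hc]

/-- A statement about `overflow k H (c :: x)` and `overflow k H (c :: y)` follows from the
statements about the queues that remain after the first label. -/
lemma overflow_rel_cons {r : ℕ → ℕ → Prop} (hr : ∀ m n, r m n → r (m + 1) (n + 1))
    {k : ℕ} {c : ℕ} {x y : List ℕ} (H : Multiset ℕ)
    (h₁ : ∀ H, r (overflow k H x) (overflow k H y))
    (h₂ : c < k → ∀ H, r (overflow k H (x ++ [c + 1])) (overflow k H (y ++ [c + 1]))) :
    r (overflow k H (c :: x)) (overflow k H (c :: y)) := by
  rcases le_or_gt k c with hk | hk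
  · rw [overflow_discard hk, overflow_discard hk]
    exact hr _ _ (h₁ H)
  · by_cases hc : c ∈ H
    · obtain ⟨H, rfl⟩ := Multiset.exists_cons_of_mem hc
      rw [overflow_insert hk, overflow_insert hk]
      exact h₁ _
    · rw [overflow_cycle hk hc, overflow_cycle hk hc]
      exact h₂ hk H

/-! ### Local moves on queues -/

/-- The elementary moves under which `overflow` is invariant. -/
inductive LocalMove : List ℕ → List ℕ → Prop
  | far (a b : ℕ) (h : a + 2 ≤ b) : LocalMove [a, b] [b, a]
  | upper (a : ℕ) : LocalMove [a + 1, a, a + 1] [a, a + 1, a + 1]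
  | lower (a : ℕ) : LocalMove [a, a + 1, a] [a, a, a + 1]

/-- Inserting one of the labels alters only columns of its own height and the next, so when `b`
exceeds `a` by two or more, inserting `a` never decides whether `b` fits, nor conversely. If both
labels cycle, the same pair returns at the end of the queue, raised by one; `ih` covers that case
only. -/
lemma overflow_far {k a b : ℕ} (hab : a + 2 ≤ b) (H : Multiset ℕ) (B : List ℕ)
    (ih : b < k →
      overflow k H (B ++ [a + 1, b + 1]) = overflow k H (B ++ [b + 1, a + 1])) :
    overflow k H (a :: b :: B) = overflow k H (b :: a :: B) := by
  rcases le_or_gt k a with ha | ha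
  · have hb : k ≤ b := by omega
    simp [overflow_discard, ha, hb]
  by_cases hbk : k ≤ b
  · rw [overflow_discard hbk]
    by_cases hm : a ∈ H
    · obtain ⟨H, rfl⟩ := Multiset.exists_cons_of_mem hm
      rw [overflow_insert ha, overflow_insert ha, overflow_discard hbk]
    · rw [overflow_cycle ha hm, overflow_cycle ha hm, List.cons_append, overflow_discard hbk]
  push Not at hbk
  by_cases hm : a ∈ H
  · obtain ⟨H, rfl⟩ := Multiset.exists_cons_of_mem hm
    rw [overflow_insert ha]
    by_cases hm' : b ∈ H
    · obtain ⟨H, rfl⟩ := Multiset.exists_cons_of_mem hm'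
      rw [Multiset.cons_swap, overflow_insert hbk, Multiset.cons_swap a, overflow_insert hbk,
        Multiset.cons_swap _ a, overflow_insert ha, Multiset.cons_swap]
    · rw [overflow_cycle hbk (by simp [hm']; omega), overflow_cycle hbk (by simp [hm']; omega),
        List.cons_append, overflow_insert ha]
  · rw [overflow_cycle ha hm, List.cons_append]
    by_cases hm' : b ∈ H
    · obtain ⟨H, rfl⟩ := Multiset.exists_cons_of_mem hm'
      simp only [Multiset.mem_cons, not_or] at hm
      rw [overflow_insert hbk, overflow_insert hbk, overflow_cycle ha (by simp [hm]; omega)]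
    · rw [overflow_cycle hbk hm', overflow_cycle hbk hm', List.cons_append, overflow_cycle ha hm]
      simpa using ih hbk

/-- The labels `a` and `a + 1` need not commute, as inserting `a` creates a column of height `a +
1`. The second `a + 1` compensates: when that column is the only one available, exactly one of the
two labels `a + 1` enters it and the other cycles, in either order. -/
lemma overflow_upper {k a : ℕ} (H : Multiset ℕ) (B : List ℕ)
    (ih : a + 1 < k →
      overflow k H (B ++ [a + 2, a + 1, a + 2]) = overflow k H (B ++ [a + 1, a + 2, a + 2])) :
    overflow k H ((a + 1) :: a :: (a + 1) :: B) = overflow k H (a :: (a + 1) :: (a + 1) :: B) := by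
  rcases le_or_gt k a with ha | ha
  · have hb : k ≤ a + 1 := by omega
    simp [overflow_discard, ha, hb]
  by_cases hbk : k ≤ a + 1
  · rw [overflow_discard hbk]
    by_cases hm : a ∈ H
    · obtain ⟨H, rfl⟩ := Multiset.exists_cons_of_mem hm
      rw [overflow_insert ha, overflow_insert ha]
      simp only [overflow_discard hbk]
    · rw [overflow_cycle ha hm, overflow_cycle ha hm, List.cons_append, List.cons_append,
        overflow_discard hbk, overflow_discard hbk]
      simp [overflow_discard hbk]
  push Not at hbk
  by_cases hm : a ∈ H
  · obtain ⟨H, rfl⟩ := Multiset.exists_cons_of_mem hm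
    rw [overflow_insert ha, overflow_insert hbk]
    by_cases hm' : a + 1 ∈ H
    · obtain ⟨H, rfl⟩ := Multiset.exists_cons_of_mem hm'
      rw [Multiset.cons_swap a, overflow_insert hbk, Multiset.cons_swap _ a, overflow_insert ha,
        Multiset.cons_swap]
    · rw [overflow_cycle hbk (by simp [hm']), List.cons_append, overflow_insert ha,
        List.cons_append, overflow_insert hbk, overflow_cycle hbk (by simp [hm'])]
  · rw [overflow_cycle ha hm, List.cons_append]
    by_cases hm' : a + 1 ∈ H
    · obtain ⟨H, rfl⟩ := Multiset.exists_cons_of_mem hm'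
      simp only [Multiset.mem_cons, not_or] at hm
      rw [overflow_insert hbk, overflow_insert hbk, overflow_cycle ha (by simp [hm]; omega),
        List.cons_append]
    · rw [overflow_cycle hbk hm', overflow_cycle hbk hm', List.cons_append, overflow_cycle ha hm]
      simp only [List.cons_append]
      rw [overflow_cycle hbk hm', overflow_cycle hbk hm']
      simpa using ih hbk

/-- Here the spare label is an `a`: if there is one column of height `a` and none of height `a + 1`,
the first `a` and the `a + 1` enter that column one after the other, and the second `a` cycles,
wherever it stands. -/
lemma overflow_lower {k a : ℕ} (H : Multiset ℕ) (B : List ℕ)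
    (ih : a + 1 < k →
      overflow k H (B ++ [a + 1, a + 2, a + 1]) = overflow k H (B ++ [a + 1, a + 1, a + 2])) :
    overflow k H (a :: (a + 1) :: a :: B) = overflow k H (a :: a :: (a + 1) :: B) := by
  rcases le_or_gt k a with ha | ha
  · have hb : k ≤ a + 1 := by omega
    simp [overflow_discard, ha, hb]
  by_cases hbk : k ≤ a + 1
  · have key : ∀ H B, overflow k H ((a + 1) :: a :: B) = overflow k H (a :: (a + 1) :: B) := by
      intro H B
      rw [overflow_discard hbk]
      by_cases hm : a ∈ H
      · obtain ⟨H, rfl⟩ := Multiset.exists_cons_of_mem hm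
        rw [overflow_insert ha, overflow_insert ha, overflow_discard hbk]
      · rw [overflow_cycle ha hm, overflow_cycle ha hm, List.cons_append, overflow_discard hbk]
    exact overflow_rel_cons (r := Eq) (by simp) H (key · B) (fun _ H => key H (B ++ [a + 1]))
  push Not at hbk
  by_cases hm : a ∈ H
  · obtain ⟨H, rfl⟩ := Multiset.exists_cons_of_mem hm
    rw [overflow_insert ha, overflow_insert hbk, overflow_insert ha]
    by_cases hm : a ∈ H
    · obtain ⟨H, rfl⟩ := Multiset.exists_cons_of_mem hm
      rw [Multiset.cons_swap, overflow_insert ha, Multiset.cons_swap _ a, overflow_insert ha,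
        overflow_insert hbk, Multiset.cons_swap]
    · rw [overflow_cycle ha (by simp [hm]; omega), overflow_cycle ha (by simp [hm]),
        List.cons_append, overflow_insert hbk]
  · rw [overflow_cycle ha hm, overflow_cycle ha hm]
    simp only [List.cons_append]
    by_cases hm' : a + 1 ∈ H
    · obtain ⟨H, rfl⟩ := Multiset.exists_cons_of_mem hm'
      simp only [Multiset.mem_cons, not_or] at hm
      rw [overflow_insert hbk, overflow_cycle ha (by simp [hm]; omega),
        overflow_cycle ha (by simp [hm])]
      simp only [List.cons_append]
      rw [overflow_insert hbk]
    · rw [overflow_cycle hbk hm', List.cons_append, overflow_cycle ha hm, overflow_cycle ha hm]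
      simp only [List.cons_append]
      rw [overflow_cycle hbk hm']
      simpa using ih hbk

/-- Labels before the exchanged word are processed alike on both sides. Once the word is at the
head, either the two processes reach the same state or the whole word has cycled and the same kind
of move, raised by one, remains at a smaller weight. -/
lemma overflow_localMove {k : ℕ} (N : ℕ) : ∀ {u v A B : List ℕ} (H : Multiset ℕ), LocalMove u v →
    weight k (A ++ (u ++ B)) ≤ N → overflow k H (A ++ (u ++ B)) = overflow k H (A ++ (v ++ B)) := by
  induction N with
  | zero =>
    intro u v A B H h hN
    exfalso
    cases h <;> simp at hN
  | succ N ih =>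
    intro u v A B H h hN
    match A with
    | c :: A =>
      simp only [List.cons_append, weight_cons] at hN
      refine overflow_rel_cons (r := Eq) (by simp) H
        (fun H => ih H h (by omega)) (fun hc H => ?_)
      have := ih (A := A) (B := B ++ [c + 1]) H h (by simp at hN ⊢; omega)
      simpa using this
    | [] =>
      simp only [List.nil_append]
      cases h with
      | far a b hab =>
        refine overflow_far hab H B fun hk => ?_
        have := ih (A := B) (B := []) H (.far (a + 1) (b + 1) (by omega)) (by simp at hN ⊢; omega)
        simpa using this
      | upper a =>
        refine overflow_upper H B fun hk => ?_
        have := ih (A := B) (B := []) H (.upper (a + 1)) (by simp at hN ⊢; omega)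
        simpa using this
      | lower a =>
        refine overflow_lower H B fun hk => ?_
        have := ih (A := B) (B := []) H (.lower (a + 1)) (by simp at hN ⊢; omega)
        simpa using this

/-- Words that can be exchanged in every queue without a change of `overflow`. -/
def OverflowEquiv (u v : List ℕ) : Prop :=
  ∀ k H A B, overflow k H (A ++ (u ++ B)) = overflow k H (A ++ (v ++ B))

lemma LocalMove.overflowEquiv {u v : List ℕ} (h : LocalMove u v) : OverflowEquiv u v :=
  fun _ H _ _ => overflow_localMove _ H h le_rfl

lemma OverflowEquiv.refl (u : List ℕ) : OverflowEquiv u u := fun _ _ _ _ => rfl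

lemma OverflowEquiv.symm {u v : List ℕ} (h : OverflowEquiv u v) : OverflowEquiv v u :=
  fun k H A B => (h k H A B).symm

lemma OverflowEquiv.trans {u v w : List ℕ} (h : OverflowEquiv u v) (h' : OverflowEquiv v w) :
    OverflowEquiv u w :=
  fun k H A B => (h k H A B).trans (h' k H A B)

lemma OverflowEquiv.append_left {u v : List ℕ} (h : OverflowEquiv u v) (x : List ℕ) :
    OverflowEquiv (x ++ u) (x ++ v) :=
  fun k H A B => by simpa using h k H (A ++ x) B

lemma OverflowEquiv.append_right {u v : List ℕ} (h : OverflowEquiv u v) (x : List ℕ) :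
    OverflowEquiv (u ++ x) (v ++ x) :=
  fun k H A B => by simpa using h k H A (x ++ B)

lemma overflowEquiv_cons_of_far {m : ℕ} {x : List ℕ} (h : ∀ c ∈ x, c + 2 ≤ m ∨ m + 2 ≤ c) :
    OverflowEquiv (m :: x) (x ++ [m]) := by
  induction x with
  | nil => exact .refl _
  | cons c x ih =>
    have h₁ : OverflowEquiv [m, c] [c, m] := by
      rcases h c (by simp) with hc | hc
      · exact (LocalMove.far c m hc).overflowEquiv.symm
      · exact (LocalMove.far m c hc).overflowEquiv
    have h₂ := (ih fun d hd => h d (by simp [hd])).append_left [c]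
    exact (h₁.append_right x).trans h₂

/-- A label commutes with an interval that contains it and its predecessor. -/
lemma overflowEquiv_cons_range' {a r m : ℕ} (h₁ : a < m) (h₂ : m < a + r) :
    OverflowEquiv (m :: List.range' a r) (List.range' a r ++ [m]) := by
  -- Split the interval around `m - 1, m`. The label `m` passes the part below `m - 1` by far moves,
  -- `m - 1, m` by an upper move, then `m, m + 1` (if `m + 1` is present) by a lower move, and the
  -- rest by far moves.
  obtain ⟨p, rfl⟩ : ∃ p, m = a + p + 1 := ⟨m - a - 1, by omega⟩
  obtain ⟨q, rfl⟩ : ∃ q, r = p + (2 + q) := ⟨r - p - 2, by omega⟩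
  rw [← List.range'_append_1, ← List.range'_append_1]
  have e : List.range' (a + p) 2 = [a + p, a + p + 1] := rfl
  rw [e]
  have h₁ : OverflowEquiv ((a + p + 1) :: List.range' a p) (List.range' a p ++ [a + p + 1]) :=
    overflowEquiv_cons_of_far fun c hc => by simp at hc; omega
  have h₂ := (LocalMove.upper (a + p)).overflowEquiv
  have h₄ : OverflowEquiv ([a + p + 1, a + p + 1] ++ List.range' (a + p + 2) q)
      ([a + p + 1] ++ List.range' (a + p + 2) q ++ [a + p + 1]) := by
    cases q with
    | zero => exact .refl _
    | succ q =>
      rw [List.range'_succ]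
      have h₅ := (LocalMove.lower (a + p + 1)).overflowEquiv.symm
      have h₆ : OverflowEquiv ((a + p + 1) :: List.range' (a + p + 2 + 1) q)
          (List.range' (a + p + 2 + 1) q ++ [a + p + 1]) :=
        overflowEquiv_cons_of_far fun c hc => by simp at hc; omega
      have h₇ := h₅.append_right (List.range' (a + p + 2 + 1) q)
      have h₈ := h₆.append_left [a + p + 1, a + p + 2]
      exact h₇.trans (by simpa using h₈)
  have g₁ := h₁.append_right ([a + p, a + p + 1] ++ List.range' (a + p + 2) q)
  have g₂ := (h₂.append_left (List.range' a p)).append_right (List.range' (a + p + 2) q)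
  have g₄ := h₄.append_left (List.range' a p ++ [a + p])
  simp only [List.append_assoc, List.cons_append, List.nil_append] at g₁ g₂ g₄ ⊢
  exact g₁.trans (g₂.trans g₄)

/-! ### Monotonicity of the process -/

/-- Raising a column of height `a` by `r` boxes instead of appending the labels `a + 1, …, a + r` to
the queue does not increase the overflow. -/
def RaiseLE (k N : ℕ) : Prop :=
  ∀ (H : Multiset ℕ) (a r : ℕ) (y : List ℕ), a + r ≤ k →
    weight k (y ++ List.range' (a + 1) r) ≤ N →
    overflow k ((a + r) ::ₘ H) y ≤ overflow k (a ::ₘ H) (y ++ List.range' (a + 1) r)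

/-- Processing a label before its successor does not increase the overflow. -/
def SwapLE (k N : ℕ) : Prop :=
  ∀ (H : Multiset ℕ) (a : ℕ) (A B : List ℕ), weight k (A ++ a :: (a + 1) :: B) ≤ N →
    overflow k H (A ++ a :: (a + 1) :: B) ≤ overflow k H (A ++ (a + 1) :: a :: B)

lemma swapLE_succ {k N : ℕ} (hr : RaiseLE k N) (hs : SwapLE k N) : SwapLE k (N + 1) := by
  intro H a A B hN
  match A with
  | c :: A =>
    simp only [List.cons_append, weight_cons] at hN
    refine overflow_rel_cons (r := LE.le) (by simp) H
      (fun H => hs H a A B (by omega)) (fun hc H => ?_)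
    have := hs H a A (B ++ [c + 1]) (by simp at hN ⊢; omega)
    simpa using this
  | [] =>
    simp only [List.nil_append] at hN ⊢
    simp only [weight_cons] at hN
    rcases le_or_gt k a with ha | ha
    · have hb : k ≤ a + 1 := by omega
      simp [overflow_discard, ha, hb]
    by_cases hbk : k ≤ a + 1
    · rw [overflow_discard hbk]
      by_cases hm : a ∈ H
      · obtain ⟨H, rfl⟩ := Multiset.exists_cons_of_mem hm
        rw [overflow_insert ha, overflow_insert ha, overflow_discard hbk]
      · rw [overflow_cycle ha hm, overflow_cycle ha hm, List.cons_append, overflow_discard hbk]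
    push Not at hbk
    by_cases hm : a ∈ H
    · obtain ⟨H, rfl⟩ := Multiset.exists_cons_of_mem hm
      rw [overflow_insert ha, overflow_insert hbk]
      by_cases hm' : a + 1 ∈ H
      · obtain ⟨H, rfl⟩ := Multiset.exists_cons_of_mem hm'
        rw [Multiset.cons_swap a, overflow_insert hbk, Multiset.cons_swap _ a, overflow_insert ha,
          Multiset.cons_swap]
      · rw [overflow_cycle hbk (by simp [hm']), List.cons_append, overflow_insert ha]
        -- In the order `a, a + 1` one column has risen by two; in the other order it has risen by
        -- one and `a + 2` is waiting in the queue. This is the raising statement with `r = 1`.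
        exact hr H (a + 1) 1 B (by omega) (by simp; omega)
    · rw [overflow_cycle ha hm, List.cons_append]
      by_cases hm' : a + 1 ∈ H
      · obtain ⟨H, rfl⟩ := Multiset.exists_cons_of_mem hm'
        simp only [Multiset.mem_cons, not_or] at hm
        rw [overflow_insert hbk, overflow_insert hbk, overflow_cycle ha (by simp [hm]; omega)]
      · rw [overflow_cycle hbk hm', overflow_cycle hbk hm', List.cons_append, overflow_cycle ha hm]
        have := hs H (a + 1) B [] (by simp; omega)
        simpa using this

/-- Only `r = 1` is needed elsewhere, but the induction forces general `r`: a head label `a` is used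
only by the lower column and shortens the gap, while a head label `a + r` is used only by the higher
one and lengthens it. -/
lemma raiseLE_succ {k N : ℕ} (hr : RaiseLE k N) (hs : SwapLE k N) : RaiseLE k (N + 1) := by
  intro H a r y hk hN
  match y with
  | [] => simp
  | c :: y =>
    simp only [List.cons_append, weight_cons] at hN
    rcases Nat.eq_zero_or_pos r with rfl | hr0
    · simp
    rw [List.cons_append]
    rcases le_or_gt k c with hc | hc
    · rw [overflow_discard hc, overflow_discard hc]
      exact Nat.succ_le_succ (hr H a r y hk (by omega))
    by_cases hm : c ∈ H
    · obtain ⟨H, rfl⟩ := Multiset.exists_cons_of_mem hm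
      rw [Multiset.cons_swap, overflow_insert hc, Multiset.cons_swap a, overflow_insert hc,
        Multiset.cons_swap, Multiset.cons_swap _ a]
      exact hr _ a r y hk (by omega)
    by_cases hca : c = a
    · subst hca
      rw [overflow_insert hc, overflow_cycle hc (by simp [hm]; omega)]
      obtain ⟨r, rfl⟩ : ∃ q, r = q + 1 := ⟨r - 1, by omega⟩
      have := hr H (c + 1) r (y ++ [c + 1]) (by omega) (by
        simp only [List.range'_succ, weight_append, weight_cons, weight_nil] at hN ⊢
        omega)
      rw [show c + (r + 1) = c + 1 + r by omega]
      simpa [List.range'_succ] using this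
    rw [overflow_cycle (H := a ::ₘ H) hc (by simp [hm, hca])]
    by_cases hcr : c = a + r
    · subst hcr
      rw [overflow_insert hc]
      have := hr H a (r + 1) y (by omega) (by
        rw [List.range'_concat]
        simp only [weight_append, weight_cons, weight_nil] at hN ⊢
        omega)
      rw [List.range'_concat] at this
      simpa [show a + 1 + r = a + r + 1 by omega, add_assoc] using this
    rw [overflow_cycle (H := (a + r) ::ₘ H) hc (by simp [hm, hcr])]
    have h₁ := hr H a r (y ++ [c + 1]) hk (by
      simp only [weight_append, weight_cons, weight_nil] at hN ⊢
      omega)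
    refine h₁.trans ?_
    -- The label `c` cycled on both sides, and `c + 1` must now move past the interval `a + 1, …, a
    -- + r`. As `c` is neither `a` nor `a + r`, it commutes with the whole interval unless `c + 1 =
    -- a`; there only the inequality `SwapLE` is available.
    by_cases hlow : c + 1 = a
    · obtain ⟨r, rfl⟩ : ∃ q, r = q + 1 := ⟨r - 1, by omega⟩
      have h₂ := hs (a ::ₘ H) (c + 1) y (List.range' (a + 1 + 1) r) (by
        rw [List.range'_succ] at hN
        simp only [weight_append, weight_cons] at hN ⊢
        subst hlow
        omega)
      have h₃ : OverflowEquiv ((c + 1) :: List.range' (a + 1 + 1) r)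
          (List.range' (a + 1 + 1) r ++ [c + 1]) :=
        overflowEquiv_cons_of_far fun d hd => by simp at hd; omega
      have h₄ := h₃ k (a ::ₘ H) (y ++ [a + 1]) []
      rw [List.range'_succ]
      subst hlow
      simp only [List.append_assoc, List.cons_append, List.nil_append, List.append_nil] at h₂ h₄ ⊢
      exact h₂.trans h₄.le
    · have h₂ : OverflowEquiv ((c + 1) :: List.range' (a + 1) r)
          (List.range' (a + 1) r ++ [c + 1]) := by
        by_cases hmid : a + 1 < c + 1 ∧ c + 1 < a + 1 + r
        · exact overflowEquiv_cons_range' hmid.1 hmid.2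
        · exact overflowEquiv_cons_of_far fun d hd => by simp at hd; omega
      have h₃ := h₂ k (a ::ₘ H) y []
      simp only [List.append_assoc, List.cons_append, List.nil_append, List.append_nil] at h₃ ⊢
      exact h₃.le

lemma raiseLE_and_swapLE (k N : ℕ) : RaiseLE k N ∧ SwapLE k N := by
  induction N with
  | zero =>
    constructor
    · intro H a r y _ hN
      cases y with
      | nil => simp
      | cons c y => simp at hN
    · intro H a A B hN
      simp at hN
  | succ N ih => exact ⟨raiseLE_succ ih.1 ih.2, swapLE_succ ih.1 ih.2⟩

/-! ### Discarding and cycling labels -/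

lemma overflow_append_cons_of_le {k c : ℕ} (hc : k ≤ c) (N : ℕ) :
    ∀ (H : Multiset ℕ) (A B : List ℕ), weight k (A ++ B) ≤ N →
      overflow k H (A ++ c :: B) = overflow k H (A ++ B) + 1 := by
  induction N with
  | zero =>
    intro H A B hN
    match A with
    | [] => exact overflow_discard hc H B
    | d :: A => simp at hN
  | succ N ih =>
    intro H A B hN
    match A with
    | [] => exact overflow_discard hc H B
    | d :: A =>
      simp only [List.cons_append, weight_cons] at hN ⊢
      refine overflow_rel_cons (r := fun m n => m = n + 1) (by simp) H
        (fun H => ih H A B (by omega)) (fun hd H => ?_)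
      have := ih H A (B ++ [d + 1]) (by simp at hN ⊢; omega)
      simpa using this

lemma overflow_concat_of_le {k c : ℕ} (hc : k ≤ c) (H : Multiset ℕ) (y : List ℕ) :
    overflow k H (y ++ [c]) = overflow k H y + 1 := by
  simpa using overflow_append_cons_of_le hc _ H y [] le_rfl

/-- Sending a label through the queue once more does not decrease the overflow. -/
lemma overflow_cons_le (k : ℕ) (H : Multiset ℕ) (c : ℕ) (y : List ℕ) :
    overflow k H (c :: y) ≤ overflow k H (y ++ [c + 1]) := by
  rcases le_or_gt k c with hc | hc
  · rw [overflow_discard hc, overflow_concat_of_le (by omega)]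
  · by_cases hm : c ∈ H
    · obtain ⟨H, rfl⟩ := Multiset.exists_cons_of_mem hm
      rw [overflow_insert hc]
      exact (raiseLE_and_swapLE k _).1 H c 1 y hc le_rfl
    · rw [overflow_cycle hc hm]

/-- A label that does not fit is cycled by the process itself, and a label `c ≥ k` is discarded both
as `c` and as `c + 1`. -/
lemma overflow_cons_eq (k : ℕ) {H : Multiset ℕ} {c : ℕ} (h : k ≤ c ∨ c ∉ H) (y : List ℕ) :
    overflow k H (c :: y) = overflow k H (y ++ [c + 1]) := by
  rcases le_or_gt k c with hc | hc
  · rw [overflow_discard hc, overflow_concat_of_le (by omega)]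
  · exact overflow_cycle hc (h.resolve_left (by omega)) y

lemma overflow_append_le (k : ℕ) (H : Multiset ℕ) (x y : List ℕ) :
    overflow k H (x ++ y) ≤ overflow k H (y ++ x.map (· + 1)) := by
  induction x generalizing y with
  | nil => simp
  | cons c x ih =>
    refine (overflow_cons_le k H c (x ++ y)).trans ?_
    simpa using ih (y ++ [c + 1])

lemma overflow_append_eq (k : ℕ) {H : Multiset ℕ} {x : List ℕ} (h : ∀ c ∈ x, c ∉ H)
    (y : List ℕ) : overflow k H (x ++ y) = overflow k H (y ++ x.map (· + 1)) := by
  induction x generalizing y with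
  | nil => simp
  | cons c x ih =>
    refine (overflow_cons_eq k (.inr (h c (by simp))) (x ++ y)).trans ?_
    simpa using ih (fun d hd => h d (by simp [hd])) (y ++ [c + 1])

lemma overflow_replicate {k i : ℕ} (hi : i < k) (m : ℕ) (H : Multiset ℕ) (y : List ℕ) :
    overflow k (Multiset.replicate m i + H) (List.replicate m i ++ y) =
      overflow k (Multiset.replicate m (i + 1) + H) y := by
  induction m generalizing H with
  | zero => simp
  | succ m ih =>
    rw [Multiset.replicate_succ, Multiset.replicate_succ, List.replicate_succ, List.cons_append,
      Multiset.cons_add, overflow_insert hi, ← Multiset.add_cons, ih, Multiset.add_cons,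
      Multiset.cons_add]

lemma overflow_le_length (k : ℕ) (H : Multiset ℕ) (x : List ℕ) : overflow k H x ≤ x.length := by
  induction H, x using overflow.induct (k := k) with
  | case1 H => simp
  | case2 H c y hc ih => rw [overflow_discard hc]; simpa using ih
  | case3 H c y hc hm ih => rw [overflow, if_neg hc, if_pos hm]; simp; omega
  | case4 H c y hc hm ih => rw [overflow, if_neg hc, if_neg hm]; simpa using ih

lemma overflow_eq_length {k : ℕ} {x : List ℕ} (h : ∀ c ∈ x, k ≤ c) (H : Multiset ℕ) :
    overflow k H x = x.length := by
  induction x with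
  | nil => simp
  | cons c x ih =>
    rw [overflow_discard (h c (by simp)), ih fun d hd => h d (by simp [hd]), List.length_cons]

/-- With threshold `1`, the labels that are discarded are the nonzero ones. -/
lemma overflow_one {x : List ℕ} (m : ℕ) (H : Multiset ℕ) (hx : x.count 0 ≤ m) :
    overflow 1 (Multiset.replicate m 0 + H) x = x.countP (· ≠ 0) := by
  induction x generalizing m H with
  | nil => simp
  | cons c x ih =>
    rcases Nat.eq_zero_or_pos c with rfl | hc
    · simp only [List.count_cons_self] at hx
      obtain ⟨m, rfl⟩ : ∃ q, m = q + 1 := ⟨m - 1, by omega⟩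
      rw [Multiset.replicate_succ, Multiset.cons_add, overflow_insert one_pos, ← Multiset.add_cons,
        ih m _ (by omega)]
      simp
    · rw [List.count_cons_of_ne (by omega)] at hx
      rw [overflow_discard hc, ih m H hx, List.countP_cons_of_pos (by simp; omega)]

/-! ### Knuth equivalence and Schensted insertion -/

/-- Knuth equivalence of words with distinct letters. -/
inductive Knuth : List ℕ → List ℕ → Prop
  | refl (u : List ℕ) : Knuth u u
  | symm {u v : List ℕ} : Knuth u v → Knuth v u
  | trans {u v w : List ℕ} : Knuth u v → Knuth v w → Knuth u w
  | left (A B : List ℕ) {x y z : ℕ} (hxy : x < y) (hyz : y < z) :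
      Knuth (A ++ (y :: x :: z :: B)) (A ++ (y :: z :: x :: B))
  | right (A B : List ℕ) {x y z : ℕ} (hxy : x < y) (hyz : y < z) :
      Knuth (A ++ (x :: z :: y :: B)) (A ++ (z :: x :: y :: B))

namespace Knuth

lemma append_left {u v : List ℕ} (h : Knuth u v) (w : List ℕ) : Knuth (w ++ u) (w ++ v) := by
  induction h with
  | refl u => exact .refl _
  | symm _ ih => exact ih.symm
  | trans _ _ ih₁ ih₂ => exact ih₁.trans ih₂
  | left A B hxy hyz => simpa using Knuth.left (w ++ A) B hxy hyz
  | right A B hxy hyz => simpa using Knuth.right (w ++ A) B hxy hyz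

lemma append_right {u v : List ℕ} (h : Knuth u v) (w : List ℕ) : Knuth (u ++ w) (v ++ w) := by
  induction h with
  | refl u => exact .refl _
  | symm _ ih => exact ih.symm
  | trans _ _ ih₁ ih₂ => exact ih₁.trans ih₂
  | left A B hxy hyz => simpa using Knuth.left A (B ++ w) hxy hyz
  | right A B hxy hyz => simpa using Knuth.right A (B ++ w) hxy hyz

lemma cons {u v : List ℕ} (h : Knuth u v) (a : ℕ) : Knuth (a :: u) (a :: v) :=
  h.append_left [a]

end Knuth

/-- The small letter `a` travels left through an increasing word; at each step the letter to the
left of the exchanged pair is the middle one of the three and witnesses the Knuth move. -/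
lemma knuth_cons_concat {a b : ℕ} {r : List ℕ} (hab : a < b) (hr : (b :: r).Pairwise (· < ·)) :
    Knuth (b :: (r ++ [a])) (b :: a :: r) := by
  induction r generalizing b with
  | nil => exact .refl _
  | cons c r ih =>
    have hbc : b < c := (List.pairwise_cons.1 hr).1 c (by simp)
    have h := (ih (hab.trans hbc) (List.pairwise_cons.1 hr).2).cons b
    exact h.trans (Knuth.left [] r hab hbc).symm

lemma rowInsert_none {a : ℕ} {r : List ℕ} (h : (rowInsert a r).2 = none) :
    (rowInsert a r).1 = r ++ [a] := by
  induction r with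
  | nil => rfl
  | cons b r ih =>
    rw [rowInsert] at h ⊢
    split_ifs at h ⊢ with hab
    simpa using ih h

lemma rowInsert_perm (a : ℕ) (r : List ℕ) :
    ((rowInsert a r).2.toList ++ (rowInsert a r).1).Perm (a :: r) := by
  induction r with
  | nil => exact .refl _
  | cons b r ih =>
    rw [rowInsert]
    split_ifs with hab
    · exact List.Perm.swap a b r
    · exact List.perm_middle.trans ((ih.cons b).trans (List.Perm.swap a b r))

lemma rowInsert_pairwise {a : ℕ} {r : List ℕ} (hr : r.Pairwise (· < ·)) (ha : a ∉ r) :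
    (rowInsert a r).1.Pairwise (· < ·) := by
  induction r with
  | nil => simp [rowInsert]
  | cons b r ih =>
    rw [List.pairwise_cons] at hr
    simp only [List.mem_cons, not_or] at ha
    rw [rowInsert]
    split_ifs with hab
    · exact List.pairwise_cons.2 ⟨fun c hc => hab.trans (hr.1 c hc), hr.2⟩
    · refine List.pairwise_cons.2 ⟨fun c hc => ?_, ih hr.2 ha.2⟩
      have : c ∈ a :: r := (rowInsert_perm a r).mem_iff.1 (List.mem_append_right _ hc)
      rcases List.mem_cons.1 this with rfl | hc
      · omega
      · exact hr.1 c hc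

/-- The clause on the first letter `c` of the new row feeds the induction: the bumped letter `e`
moves left past `b` by a Knuth move that needs a witness strictly between `b` and `e` just after
them. -/
lemma rowInsert_some {a e : ℕ} {r : List ℕ} (hr : r.Pairwise (· < ·)) (ha : a ∉ r)
    (h : (rowInsert a r).2 = some e) :
    Knuth (r ++ [a]) (e :: (rowInsert a r).1) ∧
      ∃ c t, (rowInsert a r).1 = c :: t ∧ c < e ∧ (c = a ∨ c ∈ r) := by
  induction r with
  | nil => simp [rowInsert] at h
  | cons b r ih =>
    rw [rowInsert] at h ⊢
    simp only [List.mem_cons, not_or] at ha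
    split_ifs at h ⊢ with hab
    · obtain rfl : b = e := by simpa using h
      exact ⟨knuth_cons_concat hab hr, a, r, rfl, hab, .inl rfl⟩
    · rw [List.pairwise_cons] at hr
      obtain ⟨hk, c, t, hct, hce, hc⟩ := ih hr.2 ha.2 h
      have hbc : b < c := by
        rcases hc with rfl | hc
        · omega
        · exact hr.1 c hc
      refine ⟨(hk.cons b).trans ?_, b, _, rfl, hbc.trans hce, .inr (by simp)⟩
      rw [hct]
      exact Knuth.right [] t hbc hce

/-! ### Reading words of insertion tableaux -/

@[simp] lemma rowWord_cons (r : List ℕ) (T : List (List ℕ)) : rowWord (r :: T) = rowWord T ++ r := by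
  simp [rowWord]

@[simp] lemma rowWord_nil : rowWord [] = [] := rfl

lemma tableauInsert_cons_none {a : ℕ} {r : List ℕ} {T : List (List ℕ)}
    (h : (rowInsert a r).2 = none) : tableauInsert (r :: T) a = (r ++ [a]) :: T := by
  rw [tableauInsert, ← rowInsert_none h]
  split <;> simp_all

lemma tableauInsert_cons_some {a b : ℕ} {r : List ℕ} {T : List (List ℕ)}
    (h : (rowInsert a r).2 = some b) :
    tableauInsert (r :: T) a = (rowInsert a r).1 :: tableauInsert T b := by
  rw [tableauInsert]
  split <;> simp_all

lemma rowWord_tableauInsert {T : List (List ℕ)} {a : ℕ} (hT : ∀ r ∈ T, r.Pairwise (· < ·))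
    (hn : (rowWord T ++ [a]).Nodup) :
    Knuth (rowWord T ++ [a]) (rowWord (tableauInsert T a)) ∧
      (rowWord (tableauInsert T a)).Perm (rowWord T ++ [a]) ∧
      ∀ r ∈ tableauInsert T a, r.Pairwise (· < ·) := by
  induction T generalizing a with
  | nil => exact ⟨.refl _, .refl _, by simp [tableauInsert]⟩
  | cons r T ih =>
    have hr : r.Pairwise (· < ·) := hT r (by simp)
    rw [rowWord_cons] at hn
    have har : a ∉ r := fun h => by
      rw [List.nodup_append] at hn
      exact hn.2.2 a (by simp [h]) a (by simp) rfl
    rcases h : (rowInsert a r).2 with _ | b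
    · have hs := rowInsert_pairwise hr har
      rw [rowInsert_none h] at hs
      rw [tableauInsert_cons_none h]
      simp only [rowWord_cons, List.append_assoc]
      refine ⟨.refl _, .refl _, fun s hs' => ?_⟩
      rcases List.mem_cons.1 hs' with rfl | hs'
      · exact hs
      · exact hT s (by simp [hs'])
    · have hp := rowInsert_perm a r
      rw [h] at hp
      have hp' : (rowWord T ++ [b] ++ (rowInsert a r).1).Perm (rowWord T ++ r ++ [a]) := by
        rw [List.append_assoc, List.append_assoc]
        exact (hp.trans (List.perm_append_singleton a r).symm).append_left _
      obtain ⟨h₁, h₂, h₃⟩ := ih (a := b) (fun s hs => hT s (by simp [hs]))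
        ((hp'.nodup_iff.2 hn).sublist (List.sublist_append_left _ _))
      rw [tableauInsert_cons_some h]
      simp only [rowWord_cons]
      refine ⟨?_, (h₂.append_right _).trans hp', fun s hs => ?_⟩
      · refine Knuth.trans ?_ (h₁.append_right _)
        simpa using (rowInsert_some hr har h).1.append_left (rowWord T)
      · rcases List.mem_cons.1 hs with rfl | hs
        · exact rowInsert_pairwise hr har
        · exact h₃ s hs

lemma insertionTableau_concat (w : List ℕ) (a : ℕ) :
    insertionTableau (w ++ [a]) = tableauInsert (insertionTableau w) a := by
  simp [insertionTableau]

lemma rowWord_insertionTableau {w : List ℕ} (hn : w.Nodup) :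
    Knuth w (rowWord (insertionTableau w)) ∧ (rowWord (insertionTableau w)).Perm w ∧
      ∀ r ∈ insertionTableau w, r.Pairwise (· < ·) := by
  induction w using List.reverseRecOn with
  | nil => exact ⟨.refl _, .refl _, by simp [insertionTableau]⟩
  | append_singleton w a ih =>
    obtain ⟨h₁, h₂, h₃⟩ := ih (hn.sublist (List.sublist_append_left _ _))
    have h₄ := h₂.append_right [a]
    obtain ⟨h₅, h₆, h₇⟩ := rowWord_tableauInsert h₃ (h₄.nodup_iff.2 hn)
    rw [insertionTableau_concat]
    exact ⟨(h₁.append_right [a]).trans h₅, h₆.trans h₄, h₇⟩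

/-- The first entry of the first row is a lower bound of all entries. -/
lemma head_insertionTableau_le {w : List ℕ} (hn : w.Nodup) {r : List ℕ} {T : List (List ℕ)}
    (h : insertionTableau w = r :: T) : ∃ b t, r = b :: t ∧ ∀ c ∈ w, b ≤ c := by
  induction w using List.reverseRecOn generalizing r T with
  | nil => simp [insertionTableau] at h
  | append_singleton w a ih =>
    have hn' := hn.sublist (List.sublist_append_left w [a])
    rw [insertionTableau_concat] at h
    rcases h' : insertionTableau w with _ | ⟨r', T'⟩
    · have hp := (rowWord_insertionTableau hn').2.1
      rw [h', rowWord_nil] at hp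
      obtain rfl := hp.symm.eq_nil
      rw [h', tableauInsert] at h
      simp only [List.cons.injEq] at h
      exact ⟨a, [], h.1.symm, by simp⟩
    · obtain ⟨b, t, rfl, hb⟩ := ih hn' h'
      rw [h'] at h
      rcases hab : decide (a < b) with _ | _
      · have hab : ¬ a < b := by simpa using hab
        have e : (rowInsert a (b :: t)).1 = b :: (rowInsert a t).1 := by rw [rowInsert, if_neg hab]
        refine ⟨b, (rowInsert a t).1, ?_, by
          simp only [List.mem_append, List.mem_singleton]
          rintro c (hc | rfl)
          · exact hb c hc
          · omega⟩
        rcases h₂ : (rowInsert a (b :: t)).2 with _ | d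
        · rw [tableauInsert_cons_none h₂, ← rowInsert_none h₂, e] at h
          simp only [List.cons.injEq] at h
          exact h.1.symm
        · rw [tableauInsert_cons_some h₂, e] at h
          simp only [List.cons.injEq] at h
          exact h.1.symm
      · have hab : a < b := by simpa using hab
        have e : rowInsert a (b :: t) = (a :: t, some b) := by rw [rowInsert, if_pos hab]
        refine ⟨a, t, ?_, by
          simp only [List.mem_append, List.mem_singleton]
          rintro c (hc | rfl)
          · exact hab.le.trans (hb c hc)
          · rfl⟩
        rw [tableauInsert_cons_some (b := b) (by rw [e]), e] at h
        simp only [List.cons.injEq] at h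
        exact h.1.symm

/-! ### Cocharge labelings of words in an interval of letters -/

/-- The condition of the cocharge labeling on the labels of the letters `a` and `b`, if `a` stands
to the left of `b`. -/
def LabelRel (ℓ : ℕ → ℕ) (a b : ℕ) : Prop :=
  (b = a + 1 → ℓ b = ℓ a) ∧ (a = b + 1 → ℓ a = ℓ b + 1)

/-- `w` contains each of the letters `s + 1, …, s + N` once, and `ℓ` is, up to the label of `s + 1`,
its cocharge labeling. -/
structure IsCochargeLabeling (ℓ : ℕ → ℕ) (s N : ℕ) (w : List ℕ) : Prop where
  perm : w.Perm (List.range' (s + 1) N)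
  pairwise : w.Pairwise (LabelRel ℓ)

/-- The labels of the letters of a word, read from right to left. -/
def labelQueue (ℓ : ℕ → ℕ) (w : List ℕ) : List ℕ := (w.map ℓ).reverse

@[simp] lemma labelQueue_append (ℓ : ℕ → ℕ) (u v : List ℕ) :
    labelQueue ℓ (u ++ v) = labelQueue ℓ v ++ labelQueue ℓ u := by
  simp [labelQueue]

lemma labelRel_far {ℓ : ℕ → ℕ} {a b : ℕ} (h : a + 1 < b) : LabelRel ℓ a b ∧ LabelRel ℓ b a := by
  refine ⟨⟨?_, ?_⟩, ⟨?_, ?_⟩⟩ <;> intro h' <;> omega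

namespace IsCochargeLabeling

variable {ℓ : ℕ → ℕ} {s N : ℕ} {w : List ℕ}

lemma nodup (h : IsCochargeLabeling ℓ s N w) : w.Nodup :=
  h.perm.nodup_iff.2 List.nodup_range'

lemma mem_iff (h : IsCochargeLabeling ℓ s N w) {a : ℕ} : a ∈ w ↔ s + 1 ≤ a ∧ a < s + 1 + N := by
  rw [h.perm.mem_iff]
  simp

lemma length_eq (h : IsCochargeLabeling ℓ s N w) : w.length = N := by
  simpa using h.perm.length_eq

lemma length_labelQueue (h : IsCochargeLabeling ℓ s N w) : (labelQueue ℓ w).length = N := by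
  simpa [labelQueue] using h.length_eq

lemma le_succ (h : IsCochargeLabeling ℓ s N w) {a : ℕ} (ha : a ∈ w) (hb : a + 1 ∈ w) :
    ℓ a ≤ ℓ (a + 1) := by
  -- `LabelRel` depends on which letter stands first. The weaker symmetric relation `R` can be
  -- applied to `a` and `a + 1` in either position.
  let R : ℕ → ℕ → Prop := fun a b => (b = a + 1 → ℓ a ≤ ℓ b) ∧ (a = b + 1 → ℓ b ≤ ℓ a)
  have : Std.Symm R := ⟨fun a b hab => ⟨hab.2, hab.1⟩⟩
  have hR : w.Pairwise R := h.pairwise.imp fun {a b} hab =>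
    ⟨fun e => (hab.1 e).ge, fun e => by have := hab.2 e; omega⟩
  exact (hR.forall ha hb (by omega)).1 rfl

lemma mono (h : IsCochargeLabeling ℓ s N w) {a b : ℕ} (ha : a ∈ w) (hb : b ∈ w) (hab : a ≤ b) :
    ℓ a ≤ ℓ b := by
  induction b, hab using Nat.le_induction with
  | base => exact le_rfl
  | succ b hab ih =>
    have hb' : b ∈ w := by
      rw [h.mem_iff] at ha hb ⊢
      omega
    exact (ih hb').trans (h.le_succ hb' hb)

/-- On the way from `a` in `v` up to `b` in `u`, some letter `c + 1` must lie in `u` while `c` lies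
in `v`, and there the label goes up. -/
lemma strict {u v : List ℕ} (h : IsCochargeLabeling ℓ s N (u ++ v)) {a b : ℕ} (hb : b ∈ u)
    (ha : a ∈ v) (hab : a < b) : ℓ a < ℓ b := by
  by_contra hlt
  have key : ∀ c, a ≤ c → c ≤ b → c ∈ v := by
    intro c hc
    induction c, hc using Nat.le_induction with
    | base => exact fun _ => ha
    | succ c hac ih =>
      intro hcb
      have hcv := ih (by omega)
      have hcw : c + 1 ∈ u ++ v := by
        have h₁ := h.mem_iff.1 (List.mem_append_right u ha)
        have h₂ := h.mem_iff.1 (List.mem_append_left v hb)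
        rw [h.mem_iff]
        omega
      rcases List.mem_append.1 hcw with hcu | hcv'
      · have h₁ := ((List.pairwise_append.1 h.pairwise).2.2 _ hcu _ hcv).2 rfl
        have h₂ := h.mono (List.mem_append_right u ha) (List.mem_append_right u hcv) hac
        have h₃ := h.mono hcw (List.mem_append_left v hb) hcb
        omega
      · exact hcv'
  exact (List.nodup_append.1 h.nodup).2.2 b hb b (key b hab.le le_rfl) rfl

/-- Only consecutive letters constrain each other's labels. A Knuth move exchanges letters with
another one strictly between them, so it keeps the same labeling `ℓ`. -/
lemma swap {A B : List ℕ} {x z : ℕ} (hxz : x + 1 < z) :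
    IsCochargeLabeling ℓ s N (A ++ (x :: z :: B)) ↔
      IsCochargeLabeling ℓ s N (A ++ (z :: x :: B)) := by
  have hp : (A ++ (x :: z :: B)).Perm (A ++ (z :: x :: B)) := (List.Perm.swap z x B).append_left A
  have hr : (A ++ (x :: z :: B)).Pairwise (LabelRel ℓ) ↔
      (A ++ (z :: x :: B)).Pairwise (LabelRel ℓ) := by
    have := labelRel_far (ℓ := ℓ) hxz
    simp only [List.pairwise_append, List.pairwise_cons, List.mem_cons, forall_eq_or_imp]
    constructor
    · rintro ⟨h₁, ⟨⟨-, h₂⟩, h₃, h₄⟩, h₅⟩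
      exact ⟨h₁, ⟨⟨this.2, h₃⟩, h₂, h₄⟩,
        fun a ha => ⟨(h₅ a ha).2.1, (h₅ a ha).1, (h₅ a ha).2.2⟩⟩
    · rintro ⟨h₁, ⟨⟨-, h₂⟩, h₃, h₄⟩, h₅⟩
      exact ⟨h₁, ⟨⟨this.1, h₃⟩, h₂, h₄⟩,
        fun a ha => ⟨(h₅ a ha).2.1, (h₅ a ha).1, (h₅ a ha).2.2⟩⟩
  exact ⟨fun h => ⟨hp.symm.trans h.perm, hr.1 h.pairwise⟩,
    fun h => ⟨hp.trans h.perm, hr.2 h.pairwise⟩⟩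

lemma knuth_iff {u v : List ℕ} (huv : Knuth u v) :
    IsCochargeLabeling ℓ s N u ↔ IsCochargeLabeling ℓ s N v := by
  induction huv with
  | refl u => rfl
  | symm _ ih => exact ih.symm
  | trans _ _ ih₁ ih₂ => exact ih₁.trans ih₂
  | @left A B x y z hxy hyz =>
    simpa using swap (ℓ := ℓ) (s := s) (N := N) (A := A ++ [y]) (B := B) (x := x) (z := z)
      (by omega)
  | @right A B x y z hxy hyz => exact swap (by omega)

/-- The order of the three letters restricts their labels. If the exchanged labels differ by two or
more, the exchange is a far move. Otherwise the witness `y` has the label of `z` (an upper move) or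
of `x` (a lower move). -/
lemma overflow_eq_of_knuth {u v : List ℕ} (huv : Knuth u v) (h : IsCochargeLabeling ℓ s N u)
    (k : ℕ) (H : Multiset ℕ) : overflow k H (labelQueue ℓ u) = overflow k H (labelQueue ℓ v) := by
  induction huv with
  | refl u => rfl
  | symm huv ih => exact (ih ((knuth_iff huv).2 h)).symm
  | trans huv _ ih₁ ih₂ => exact (ih₁ h).trans (ih₂ ((knuth_iff huv).1 h))
  | @left A B x y z hxy hyz =>
    have h₁ : ℓ x < ℓ y := by
      have h' : IsCochargeLabeling ℓ s N ((A ++ [y]) ++ (x :: z :: B)) := by simpa using h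
      exact h'.strict (by simp) (by simp) hxy
    have h₂ : ℓ y ≤ ℓ z := h.mono (by simp) (by simp) hyz.le
    have key : OverflowEquiv [ℓ z, ℓ x, ℓ y] [ℓ x, ℓ z, ℓ y] := by
      rcases Nat.lt_or_ge (ℓ x + 1) (ℓ z) with h₃ | h₃
      · exact (LocalMove.far _ _ h₃).overflowEquiv.symm.append_right [ℓ y]
      · rw [show ℓ y = ℓ x + 1 by omega, show ℓ z = ℓ x + 1 by omega]
        exact (LocalMove.upper _).overflowEquiv
    simpa [labelQueue] using key k H (labelQueue ℓ B) (labelQueue ℓ A)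
  | @right A B x y z hxy hyz =>
    have h₁ : ℓ y < ℓ z := by
      have h' : IsCochargeLabeling ℓ s N ((A ++ [x, z]) ++ (y :: B)) := by simpa using h
      exact h'.strict (by simp) (by simp) hyz
    have h₂ : ℓ x ≤ ℓ y := h.mono (by simp) (by simp) hxy.le
    have key : OverflowEquiv [ℓ y, ℓ z, ℓ x] [ℓ y, ℓ x, ℓ z] := by
      rcases Nat.lt_or_ge (ℓ x + 1) (ℓ z) with h₃ | h₃
      · exact (LocalMove.far _ _ h₃).overflowEquiv.symm.append_left [ℓ y]
      · rw [show ℓ y = ℓ x by omega, show ℓ z = ℓ x + 1 by omega]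
        exact (LocalMove.lower _).overflowEquiv
    simpa [labelQueue] using key k H (labelQueue ℓ B) (labelQueue ℓ A)

/-- Moving a suffix that does not contain the first letter to the front raises its labels by one. -/
lemma rotate {u v : List ℕ} (h : (u ++ v).Pairwise (LabelRel ℓ)) (hn : (u ++ v).Nodup) :
    (v ++ u).Pairwise (LabelRel fun x => if x ∈ v then ℓ x + 1 else ℓ x) := by
  obtain ⟨hu, hv, huv⟩ := List.pairwise_append.1 h
  have hd : ∀ a ∈ u, a ∉ v := fun a ha hav => (List.nodup_append.1 hn).2.2 a ha a hav rfl
  refine List.pairwise_append.2 ⟨hv.imp_of_mem fun {a b} ha hb hab => ?_,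
    hu.imp_of_mem fun {a b} ha hb hab => ?_, fun a ha b hb => ?_⟩
  · simpa only [LabelRel, ha, hb, if_true, Nat.add_right_cancel_iff] using hab
  · simpa only [LabelRel, hd a ha, hd b hb, if_false] using hab
  · have := huv b hb a ha
    simp only [LabelRel, ha, hd b hb, if_true, if_false, Nat.add_right_cancel_iff] at this ⊢
    exact ⟨this.2, this.1⟩

end IsCochargeLabeling

/-- Rotating the word by a suffix is, on queues, cycling the initial block formed by the labels of
that suffix. This covers both corotations and catabolisms. -/
lemma labelQueue_rotate {ℓ : ℕ → ℕ} {u v : List ℕ} (hn : (u ++ v).Nodup) :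
    labelQueue (fun x => if x ∈ v then ℓ x + 1 else ℓ x) (v ++ u) =
      labelQueue ℓ u ++ (labelQueue ℓ v).map (· + 1) := by
  have hd : ∀ a ∈ u, a ∉ v := fun a ha hav => (List.nodup_append.1 hn).2.2 a ha a hav rfl
  have h₁ : u.map (fun x => if x ∈ v then ℓ x + 1 else ℓ x) = u.map ℓ :=
    List.map_congr_left fun a ha => by simp [hd a ha]
  have h₂ : v.map (fun x => if x ∈ v then ℓ x + 1 else ℓ x) = (v.map ℓ).map (· + 1) := by
    rw [List.map_map]
    exact List.map_congr_left fun a ha => by simp [ha]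
  simp [labelQueue, h₁, h₂]

/-- An increasing list of the smallest elements of an interval is an initial interval. -/
lemma eq_range'_of_forall_lt {s N : ℕ} {x y : List ℕ} (hx : x.Pairwise (· < ·))
    (hxy : ∀ a ∈ x, ∀ b ∈ y, a < b) (h : (x ++ y).Perm (List.range' s N)) :
    x = List.range' s x.length ∧ y.Perm (List.range' (s + x.length) (N - x.length)) := by
  have hN : x.length + y.length = N := by simpa using h.length_eq
  have h₁ : (x ++ y.insertionSort (· ≤ ·)).Perm (List.range' s N) :=
    ((List.perm_insertionSort _ y).append_left x).trans h
  have h₂ : x ++ y.insertionSort (· ≤ ·) = List.range' s N := by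
    refine h₁.eq_of_pairwise' (r := (· ≤ ·)) ?_ ?_
    · refine List.pairwise_append.2 ⟨hx.imp fun h => le_of_lt h, List.pairwise_insertionSort _ _,
        fun a ha b hb => ?_⟩
      exact (hxy a ha b ((List.mem_insertionSort _).1 hb)).le
    · exact (List.pairwise_lt_range' (s := s) (n := N)).imp fun h => le_of_lt h
  rw [← hN, ← List.range'_append_1] at h₂
  obtain ⟨h₃, h₄⟩ := List.append_inj h₂ (by simp)
  refine ⟨h₃, ?_⟩
  rw [← hN, Nat.add_sub_cancel_left, ← h₄]
  exact (List.perm_insertionSort _ y).symm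

/-! ### Catabolisms as rounds of the process -/

namespace IsCochargeLabeling

variable {ℓ : ℕ → ℕ} {s N : ℕ} {w : List ℕ}

/-- The effect of a catabolism on a cocharge labeling and on the queue of its labels. -/
lemma catabolism {i m : ℕ} {r : List ℕ} {T : List (List ℕ)} (h : IsCochargeLabeling ℓ s N w)
    (hP : insertionTableau w = r :: T) (hi : ℓ (s + 1) = i) (hm : 0 < m)
    (hf : FirstRowSmallest m (r :: T)) :
    m ≤ N ∧ (r.take m).map ℓ = List.replicate m i ∧ ∃ ℓ' : ℕ → ℕ,
      IsCochargeLabeling ℓ' (s + m) (N - m) (r.drop m ++ rowWord T) ∧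
      (0 < N - m → ℓ' (s + m + 1) = i + 1) ∧
      labelQueue ℓ' (r.drop m ++ rowWord T) =
        labelQueue ℓ (rowWord T) ++ (labelQueue ℓ (r.drop m)).map (· + 1) := by
  obtain ⟨hk, -, hsorted⟩ := rowWord_insertionTableau h.nodup
  have h' := (knuth_iff hk).1 h
  rw [hP] at h' hsorted
  rw [rowWord_cons] at h'
  have hr := hsorted r (by simp)
  obtain ⟨hmr, hsm⟩ := hf
  have hlen : (r.take m).length = m := by simpa using hmr
  have hmN : m ≤ N := by
    have := h'.length_eq
    simp at this
    omega
  have hflat : ∀ b ∈ r.drop m ++ rowWord T, b ∈ r.drop m ++ T.flatten := by simp [rowWord]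
  have hperm : (r.take m ++ (r.drop m ++ rowWord T)).Perm (List.range' (s + 1) N) := by
    rw [← List.append_assoc, List.take_append_drop]
    exact List.perm_append_comm.trans h'.perm
  obtain ⟨h₁, h₂⟩ := eq_range'_of_forall_lt (hr.sublist (List.take_sublist m r))
    (fun a ha b hb => hsm a ha b (hflat b hb)) hperm
  rw [hlen] at h₁ h₂
  have hw : (rowWord T ++ (r.take m ++ r.drop m)).Pairwise (LabelRel ℓ) := by
    rw [List.take_append_drop]
    exact h'.pairwise
  obtain ⟨hT, hr', hTr⟩ := List.pairwise_append.1 hw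
  obtain ⟨hr₁, hr₂, hr₁₂⟩ := List.pairwise_append.1 hr'
  -- The removed letters are `s + 1, …, s + m`, standing in this order in one row, so the label
  -- never goes up among them.
  have hconst : ∀ j < m, ℓ (s + 1 + j) = i := by
    intro j hj
    induction j with
    | zero => exact hi
    | succ j ih =>
      rw [h₁] at hr₁
      rw [← ih (by omega)]
      have := List.pairwise_iff_getElem.1 hr₁ j (j + 1) (by simp; omega) (by simp; omega)
        (by omega)
      simp only [List.getElem_range', one_mul] at this
      exact this.1 (by omega)
  have hn : (rowWord T ++ r.drop m).Nodup :=
    h'.nodup.sublist ((List.drop_sublist m r).append_left _)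
  refine ⟨hmN, ?_, fun x => if x ∈ r.drop m then ℓ x + 1 else ℓ x, ⟨?_, ?_⟩, fun h0 => ?_,
    labelQueue_rotate hn⟩
  · refine List.eq_replicate_iff.2 ⟨by simpa using hmr, fun b hb => ?_⟩
    obtain ⟨a, ha, rfl⟩ := List.mem_map.1 hb
    rw [h₁] at ha
    simp only [List.mem_range'_1] at ha
    have := hconst (a - (s + 1)) (by omega)
    rwa [show s + 1 + (a - (s + 1)) = a by omega] at this
  · rwa [show s + m + 1 = s + 1 + m by omega]
  · exact rotate (hw.sublist ((List.sublist_append_right _ _).append_left _)) hn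
  · have hq : s + m + 1 ∈ r.drop m ++ rowWord T := h₂.mem_iff.2 (by simp; omega)
    have hp : s + m ∈ r.take m := by
      rw [h₁]
      simp
      omega
    have hpi : ℓ (s + m) = i := by
      have := hconst (m - 1) (by omega)
      rwa [show s + 1 + (m - 1) = s + m by omega] at this
    -- If the new smallest letter was in the first row, its label was `i` and the rotation raises
    -- it. If it was in a lower row, it stood to the left of `s + m` and already had the label `i +
    -- 1`.
    by_cases hq' : s + m + 1 ∈ r.drop m
    · simp only [hq', if_true]
      rw [(hr₁₂ _ hp _ hq').1 rfl, hpi]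
    · simp only [hq', if_false]
      rw [(hTr _ ((List.mem_append.1 hq).resolve_left hq') _ (List.mem_append_left _ hp)).2 rfl, hpi]

/-- If `P(w)` is `l`-catabolizable, then the process inserts at least as many labels below a
threshold as there are in the corresponding parts of `l`. -/
theorem overflow_add_sum_take_le {l : List ℕ} {i M k : ℕ} (H : Multiset ℕ)
    (h : IsCochargeLabeling ℓ s N w) (hi : 0 < N → ℓ (s + 1) = i) (hl : l.Pairwise (· ≥ ·))
    (hlM : ∀ m ∈ l, 0 < m ∧ m ≤ M) (hc : CatabolizableList l (insertionTableau w)) (hik : i ≤ k) :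
    overflow k (Multiset.replicate M i + H) (labelQueue ℓ w) + (l.take (k - i)).sum ≤ N := by
  induction l generalizing ℓ s N w i M H with
  | nil =>
    have := overflow_le_length k (Multiset.replicate M i + H) (labelQueue ℓ w)
    rw [h.length_labelQueue] at this
    simp
    omega
  | cons m l ih =>
    rcases hik.eq_or_lt with rfl | hik
    · have := overflow_le_length i (Multiset.replicate M i + H) (labelQueue ℓ w)
      rw [h.length_labelQueue] at this
      simp
      omega
    obtain ⟨hm0, hmM⟩ := hlM m (by simp)
    rw [List.pairwise_cons] at hl
    obtain ⟨hf, hc⟩ := hc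
    rcases hP : insertionTableau w with _ | ⟨r, T⟩
    · rw [hP] at hf
      simp only [FirstRowSmallest] at hf
      omega
    rw [hP] at hf hc
    have hN : 0 < N := by
      have := (rowWord_insertionTableau h.nodup).2.1.length_eq
      rw [hP, h.length_eq] at this
      have hmr := hf.1
      simp at this
      omega
    obtain ⟨hmN, hrep, ℓ', h', hi', hq⟩ := h.catabolism hP (hi hN) hm0 hf
    -- Of the `M` columns of height `i`, `m` rise to height `i + 1` and serve the next round; the
    -- other `M - m` join `H`. The later parts are at most `m`, as `hlM` demands.
    have key := ih (i := i + 1) (M := m) (Multiset.replicate (M - m) i + H) h' hi' hl.2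
      (fun a ha => ⟨(hlM a (by simp [ha])).1, hl.1 a ha⟩) hc (by omega)
    have hk := (rowWord_insertionTableau h.nodup).1
    rw [hP, rowWord_cons, ← List.take_append_drop m r] at hk
    have e : Multiset.replicate M i + H =
        Multiset.replicate m i + (Multiset.replicate (M - m) i + H) := by
      rw [← add_assoc, ← Multiset.replicate_add, Nat.add_sub_cancel' hmM]
    have e' : labelQueue ℓ (r.take m) = List.replicate m i := by
      rw [labelQueue, hrep, List.reverse_replicate]
    have step : overflow k (Multiset.replicate M i + H) (labelQueue ℓ w) ≤
        overflow k (Multiset.replicate m (i + 1) + (Multiset.replicate (M - m) i + H))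
          (labelQueue ℓ' (r.drop m ++ rowWord T)) := by
      rw [h.overflow_eq_of_knuth hk, labelQueue_append, labelQueue_append, hq, e', e,
        List.append_assoc]
      refine (overflow_append_le _ _ _ _).trans ?_
      rw [List.append_assoc, overflow_replicate hik]
    rw [show k - i = (k - (i + 1)) + 1 by omega, List.take_succ_cons, List.sum_cons]
    omega

/-- The greedy sequence of catabolisms computes the process. -/
theorem exists_catabolizableList {i M : ℕ} {H : Multiset ℕ} (h : IsCochargeLabeling ℓ s N w)
    (hi : 0 < N → ℓ (s + 1) = i) (hM : 0 < N → 0 < M) (hH : ∀ c ∈ H, c < i) :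
    ∃ l : List ℕ, l.Pairwise (· ≥ ·) ∧ (∀ m ∈ l, 0 < m ∧ m ≤ M) ∧ l.sum = N ∧
      CatabolizableList l (insertionTableau w) ∧
      ∀ k, i ≤ k →
        overflow k (Multiset.replicate M i + H) (labelQueue ℓ w) + (l.take (k - i)).sum = N := by
  induction N using Nat.strong_induction_on generalizing ℓ s w i M H with
  | _ N ih =>
    rcases Nat.eq_zero_or_pos N with rfl | hN
    · obtain rfl : w = [] := h.perm.eq_nil
      exact ⟨[], by simp, by simp, rfl, rfl, by simp [labelQueue]⟩
    replace hi := hi hN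
    replace hM := hM hN
    obtain ⟨hk, hp, hsorted⟩ := rowWord_insertionTableau h.nodup
    rcases hP : insertionTableau w with _ | ⟨r, T⟩
    · have := hp.length_eq
      rw [hP, h.length_eq] at this
      simp at this
      omega
    have h' := (knuth_iff hk).1 h
    rw [hP] at h' hsorted
    rw [rowWord_cons] at h'
    have hr := hsorted r (by simp)
    obtain ⟨b, t, rfl, hb⟩ := head_insertionTableau_le h.nodup hP
    obtain rfl : b = s + 1 := by
      have h₁ := hb (s + 1) (h.mem_iff.2 (by omega))
      have h₂ := h'.mem_iff.1 (show b ∈ rowWord T ++ b :: t by simp)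
      omega
    have hmin : ∀ a ∈ w, i ≤ ℓ a := fun a ha =>
      hi ▸ h.mono (h.mem_iff.2 (by omega)) ha (hb a ha)
    generalize hr_def : (s + 1) :: t = r at *
    have hT : ∀ a ∈ rowWord T, i < ℓ a := fun a ha => by
      have h₁ : s + 1 ∈ r := by simp [← hr_def]
      have h₂ := h'.mem_iff.1 (List.mem_append_left r ha)
      have h₃ : s + 1 ≠ a := fun e => (List.nodup_append.1 h'.nodup).2.2 a ha _ h₁ e.symm
      have h₄ := h'.strict ha h₁ (by omega)
      omega
    -- `A` is the initial run of label `i` in the first row. All other letters of the tableau have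
    -- larger labels: those of `D` since labels increase along the row, those of `T` since they are
    -- read before `s + 1`.
    set A := r.takeWhile (fun a => ℓ a = i) with hA_def
    set D := r.dropWhile (fun a => ℓ a = i) with hD_def
    have hAD : A ++ D = r := List.takeWhile_append_dropWhile
    have hA : ∀ a ∈ A, ℓ a = i := fun a ha => by simpa using List.mem_takeWhile_imp ha
    have hA0 : 0 < A.length := by
      rw [hA_def, ← hr_def, List.takeWhile_cons_of_pos (by simpa using hi)]
      simp
    have hmem : ∀ a ∈ r, a ∈ w := fun a ha =>
      h.mem_iff.2 (h'.mem_iff.1 (List.mem_append_right _ ha))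
    have hD : ∀ a ∈ D, i < ℓ a := by
      intro a ha
      rcases hDc : D with _ | ⟨d, D'⟩
      · simp [hDc] at ha
      have h₁ : ℓ d ≠ i := by
        have := List.head_dropWhile_not (fun a => decide (ℓ a = i)) (l := r)
          (by rw [← hD_def, hDc]; simp)
        simpa [← hD_def, hDc] using this
      have hdr : d ∈ r := by rw [← hAD, hDc]; simp
      have har : a ∈ r := by rw [← hAD]; simp [ha]
      have hda : d ≤ a := by
        have h₂ : D.Pairwise (· < ·) := hr.sublist (List.dropWhile_sublist _)
        rw [hDc] at h₂ ha
        rcases List.mem_cons.1 ha with rfl | ha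
        · exact le_rfl
        · exact ((List.pairwise_cons.1 h₂).1 a ha).le
      have h₂ := hmin d (hmem d hdr)
      have h₃ := h.mono (hmem d hdr) (hmem a har) hda
      omega
    -- The greedy part: one box for each label `i` of the run, as long as there are columns of
    -- height `i`.
    obtain ⟨m, hm⟩ : ∃ m, m = min A.length M := ⟨_, rfl⟩
    have hmA : m ≤ A.length := by omega
    have hdrop : r.drop m = A.drop m ++ D := by rw [← hAD, List.drop_append_of_le_length hmA]
    have htake : r.take m = A.take m := by rw [← hAD, List.take_append_of_le_length hmA]
    have hf : FirstRowSmallest m (r :: T) := by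
      refine ⟨by rw [← hAD, List.length_append]; omega, fun a ha b hb => ?_⟩
      rcases List.mem_append.1 hb with hb | hb
      · rw [← List.take_append_drop m r] at hr
        exact (List.pairwise_append.1 hr).2.2 a ha b hb
      · have hb' : b ∈ rowWord T := by simpa [rowWord] using hb
        by_contra hab
        have h₁ := h'.mono (List.mem_append_left r hb')
          (List.mem_append_right _ (List.mem_of_mem_take ha)) (not_lt.1 hab)
        have h₂ := hA a (List.mem_of_mem_take (htake ▸ ha))
        have h₃ := hT b hb'
        omega
    obtain ⟨hmN, hrep, ℓ', hℓ', hi', hq⟩ := h.catabolism hP hi (by omega) hf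
    obtain ⟨l, hl, hlm, hsum, hcat, hover⟩ := ih (N - m) (by omega) (M := m)
      (H := Multiset.replicate (M - m) i + H) hℓ' hi' (by omega) (by
        intro c hc
        rcases Multiset.mem_add.1 hc with hc | hc
        · have := Multiset.eq_of_mem_replicate hc
          omega
        · have := hH c hc
          omega)
    refine ⟨m :: l, List.pairwise_cons.2 ⟨fun a ha => (hlm a ha).2, hl⟩, fun a ha => ?_, ?_,
      ⟨hf, hcat⟩, fun k hik => ?_⟩
    · rcases List.mem_cons.1 ha with rfl | ha
      · omega
      · have := hlm a ha
        omega
    · rw [List.sum_cons]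
      omega
    rcases hik.eq_or_lt with rfl | hik
    · rw [overflow_eq_length (by simpa [labelQueue] using hmin), h.length_labelQueue]
      simp
    have e : Multiset.replicate M i + H =
        Multiset.replicate m i + (Multiset.replicate (M - m) i + H) := by
      rw [← add_assoc, ← Multiset.replicate_add, Nat.add_sub_cancel' (by omega)]
    have e₁ : labelQueue ℓ (r.take m) = List.replicate m i := by
      rw [labelQueue, hrep, List.reverse_replicate]
    have e₂ : labelQueue ℓ (A.drop m) = List.replicate (A.length - m) i := by
      rw [labelQueue, List.eq_replicate_iff]
      refine ⟨by simp, fun c hc => ?_⟩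
      obtain ⟨a, ha, rfl⟩ := List.mem_map.1 (List.mem_reverse.1 hc)
      exact hA a (List.mem_of_mem_drop ha)
    have step : overflow k (Multiset.replicate M i + H) (labelQueue ℓ w) =
        overflow k (Multiset.replicate m (i + 1) + (Multiset.replicate (M - m) i + H))
          (labelQueue ℓ' (r.drop m ++ rowWord T)) := by
      have hk' := hk
      rw [hP, rowWord_cons, ← List.take_append_drop m r] at hk'
      -- Equality holds throughout because no cycled label fits: those of `D` exceed all heights,
      -- and a surplus of labels `i` in `A` exists only if all `M` columns of height `i` have been
      -- used.
      rw [h.overflow_eq_of_knuth hk', labelQueue_append, labelQueue_append, hq, e₁, hdrop,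
        labelQueue_append, e₂, List.append_assoc, List.append_assoc, overflow_append_eq]
      · rw [← List.append_assoc, ← List.replicate_add, Nat.add_comm,
          List.replicate_add, e, List.append_assoc, List.append_assoc, overflow_replicate hik,
          overflow_append_eq]
        · simp
        · intro c hc hc'
          obtain ⟨hAm, rfl⟩ := List.mem_replicate.1 hc
          have hMm : M - m = 0 := by omega
          rw [hMm, Multiset.replicate_zero, zero_add] at hc'
          rcases Multiset.mem_add.1 hc' with hc' | hc'
          · have := Multiset.eq_of_mem_replicate hc'
            omega
          · exact (hH c hc').false
      · intro c hc hc'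
        obtain ⟨a, ha, rfl⟩ := List.mem_map.1 (List.mem_reverse.1 hc)
        have h₁ := hD a ha
        rcases Multiset.mem_add.1 hc' with hc' | hc'
        · have := Multiset.eq_of_mem_replicate hc'
          omega
        · have := hH _ hc'
          omega
    have := hover k (by omega)
    rw [step, show k - i = (k - (i + 1)) + 1 by omega, List.take_succ_cons, List.sum_cons]
    omega

end IsCochargeLabeling

/-! ### Partitions and the main theorem -/

lemma mem_sortedParts {n : ℕ} {p : n.Partition} {m : ℕ} (h : m ∈ sortedParts p) :
    0 < m ∧ m ≤ n := by
  rw [sortedParts, Multiset.mem_sort] at h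
  exact ⟨p.parts_pos h, p.parts_sum ▸ Multiset.le_sum_of_mem h⟩

lemma pairwise_sortedParts {n : ℕ} (p : n.Partition) : (sortedParts p).Pairwise (· ≥ ·) :=
  Multiset.pairwise_sort _ _

lemma sortedParts_injective {n : ℕ} : Function.Injective (sortedParts (n := n)) := by
  intro p q h
  apply Nat.Partition.ext
  rw [← Multiset.sort_eq p.parts (· ≥ ·), ← Multiset.sort_eq q.parts (· ≥ ·)]
  exact congrArg _ h

lemma exists_sortedParts_eq {n : ℕ} {l : List ℕ} (hl : l.Pairwise (· ≥ ·)) (h0 : ∀ m ∈ l, 0 < m)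
    (hsum : l.sum = n) : ∃ p : n.Partition, sortedParts p = l := by
  refine ⟨⟨l, fun {m} hm => h0 m (by simpa using hm), by simpa using hsum⟩, ?_⟩
  rw [sortedParts, Multiset.coe_sort]
  exact List.mergeSort_of_pairwise (by simpa using hl)

/-- Lists of positive numbers are determined by their partial sums. -/
lemma eq_of_sum_take_eq {l l' : List ℕ} (h0 : ∀ m ∈ l, 0 < m) (h0' : ∀ m ∈ l', 0 < m)
    (h : ∀ k, (l.take k).sum = (l'.take k).sum) : l = l' := by
  induction l generalizing l' with
  | nil =>
    cases l' with
    | nil => rfl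
    | cons a l' =>
      have := h 1
      have := h0' a (by simp)
      simp at *
      omega
  | cons b l ih =>
    cases l' with
    | nil =>
      have := h 1
      have := h0 b (by simp)
      simp at *
      omega
    | cons a l' =>
      have h₁ := h 1
      simp only [List.take_succ_cons, List.take_zero, List.sum_cons, List.sum_nil] at h₁
      obtain rfl : b = a := by omega
      exact congrArg (b :: ·) (ih (fun m hm => h0 m (List.mem_cons_of_mem _ hm))
        (fun m hm => h0' m (List.mem_cons_of_mem _ hm)) fun k => by simpa using h (k + 1))

lemma dominanceLE_antisymm {n : ℕ} {p q : n.Partition} (h : DominanceLE p q)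
    (h' : DominanceLE q p) : p = q :=
  sortedParts_injective (eq_of_sum_take_eq (fun _ hm => (mem_sortedParts hm).1)
    (fun _ hm => (mem_sortedParts hm).1) fun k => le_antisymm (h k) (h' k))

/-- A greatest element is the only maximal one. -/
lemma isCatabolizability_of_forall_dominanceLE {n : ℕ} {T : List (List ℕ)} {p : n.Partition}
    (hp : Catabolizable p T) (h : ∀ q : n.Partition, Catabolizable q T → DominanceLE q p) :
    IsCatabolizability T p :=
  ⟨⟨hp, fun q hq hpq => dominanceLE_antisymm (h q hq) hpq⟩,
    fun q hq => (hq.2 p hp (h q hq.1)).symm⟩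

/-- The catabolizability of a word with a cocharge labeling is computed by the process. -/
theorem IsCochargeLabeling.ctype_spec {ℓ : ℕ → ℕ} {n : ℕ} {w : List ℕ}
    (h : IsCochargeLabeling ℓ 0 n w) (h1 : ℓ 1 = 0) :
    IsCatabolizability (insertionTableau w) (ctype n w) ∧
      ∀ k, overflow k (Multiset.replicate n 0) (labelQueue ℓ w) +
        ((sortedParts (ctype n w)).take k).sum = n := by
  obtain ⟨l, hl, hlm, hsum, hcat, hover⟩ := h.exists_catabolizableList (i := 0) (M := n) (H := 0)
    (fun _ => h1) id (by simp)
  obtain ⟨p, rfl⟩ := exists_sortedParts_eq hl (fun m hm => (hlm m hm).1) hsum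
  simp only [add_zero, zero_le, Nat.sub_zero, true_imp_iff] at hover
  have hp : IsCatabolizability (insertionTableau w) p := by
    refine isCatabolizability_of_forall_dominanceLE hcat fun q hq k => ?_
    have h₁ := h.overflow_add_sum_take_le (k := k) 0 (fun _ => h1) (pairwise_sortedParts q)
      (fun m hm => mem_sortedParts hm) hq (Nat.zero_le k)
    have h₂ := hover k
    simp only [add_zero, Nat.sub_zero] at h₁
    omega
  have hc : IsCatabolizability (insertionTableau w) (ctype n w) :=
    Classical.epsilon_spec (p := fun p : n.Partition => IsCatabolizability _ p) ⟨p, hp⟩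
  refine ⟨hc, ?_⟩
  -- By uniqueness, the partition picked by `Classical.epsilon` is the greedy one.
  rwa [hp.2 _ hc.1]

lemma isCochargeLabeling_cochargeLabel {n : ℕ} {w : List ℕ} (h : IsStandardWord n w) :
    IsCochargeLabeling (cochargeLabel w) 0 n w := by
  refine ⟨h, ?_⟩
  have hn : w.Nodup := h.nodup_iff.2 List.nodup_range'
  have hpos : ∀ a ∈ w, 0 < a := fun a ha => by
    have := h.mem_iff.1 ha
    simp at this
    omega
  rw [List.pairwise_iff_getElem]
  intro i j hi hj hij
  have hai := hpos _ (List.getElem_mem hi)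
  have haj := hpos _ (List.getElem_mem hj)
  have ei := hn.idxOf_getElem i hi
  have ej := hn.idxOf_getElem j hj
  generalize w[i] = a at *
  generalize w[j] = b at *
  obtain ⟨a, rfl⟩ : ∃ c, a = c + 1 := ⟨a - 1, by omega⟩
  obtain ⟨b, rfl⟩ : ∃ c, b = c + 1 := ⟨b - 1, by omega⟩
  refine ⟨fun e => ?_, fun e => ?_⟩
  · obtain rfl : b = a + 1 := by omega
    rw [cochargeLabel, if_neg (by rw [ej, ei]; omega)]
  · obtain rfl : a = b + 1 := by omega
    rw [cochargeLabel, if_pos (by rw [ej, ei]; omega)]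

/-- The queue of a corotation: the first label is raised by one and goes to the end. -/
lemma IsCochargeLabeling.corotation {ℓ : ℕ → ℕ} {n a : ℕ} {w : List ℕ}
    (h : IsCochargeLabeling ℓ 0 n (w ++ [a])) (h1 : ℓ 1 = 0) (ha : a ≠ 1) :
    ∃ ℓ' : ℕ → ℕ, IsCochargeLabeling ℓ' 0 n (a :: w) ∧ ℓ' 1 = 0 ∧
      labelQueue ℓ' (a :: w) = labelQueue ℓ w ++ [ℓ a + 1] := by
  refine ⟨fun x => if x ∈ [a] then ℓ x + 1 else ℓ x,
    ⟨(List.perm_append_singleton a w).symm.trans h.perm, rotate h.pairwise h.nodup⟩,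
    by simp [ha.symm, h1], ?_⟩
  simpa [labelQueue] using labelQueue_rotate (ℓ := ℓ) h.nodup

end Catabolism

/-! ### Comparison of a word with its corotation -/

theorem mainTheorem4 (n : ℕ) (u v : List ℕ)
    (hu : Catabolism.IsStandardWord n u) (hv : Catabolism.IsStandardWord n v) :
    Catabolism.IsCatabolizability (Catabolism.insertionTableau u) (Catabolism.ctype n u) ∧
    Catabolism.IsCatabolizability (Catabolism.insertionTableau v) (Catabolism.ctype n v) ∧
    (Catabolism.IsNonzeroCorotation v u →
      Catabolism.ctype n v = Catabolism.ctype n u) ∧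
    (Catabolism.IsZeroCorotation v u →
      Catabolism.DominanceLT (Catabolism.ctype n v) (Catabolism.ctype n u)) := by
  open Catabolism in
  have hlu := isCochargeLabeling_cochargeLabel hu
  have hlv := isCochargeLabeling_cochargeLabel hv
  obtain ⟨hcu, hou⟩ := hlu.ctype_spec rfl
  refine ⟨hcu, (hlv.ctype_spec rfl).1, ?_, ?_⟩
  · rintro ⟨w, a, ha, rfl, rfl, hpos⟩
    obtain ⟨ℓ', h', h1, hq⟩ := hlu.corotation rfl ha
    have hov := (h'.ctype_spec h1).2
    have key : ∀ k, ((sortedParts (ctype n (a :: w))).take k).sum =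
        ((sortedParts (ctype n (w ++ [a]))).take k).sum := by
      intro k
      have h₁ := hou k
      have h₂ := hov k
      have h₃ := overflow_cons_eq k (H := Multiset.replicate n 0)
        (c := cochargeLabel (w ++ [a]) a)
        (.inr fun h => hpos.ne' (Multiset.eq_of_mem_replicate h))
        (labelQueue (cochargeLabel (w ++ [a])) w)
      rw [labelQueue_append] at h₁
      rw [hq, ← h₃] at h₂
      exact Nat.add_left_cancel (h₂.trans h₁.symm)
    exact dominanceLE_antisymm (fun k => (key k).le) (fun k => (key k).ge)
  · rintro ⟨w, a, ha, rfl, rfl, h0⟩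
    obtain ⟨ℓ', h', h1, hq⟩ := hlu.corotation rfl ha
    have hov := (h'.ctype_spec h1).2
    set x := labelQueue (cochargeLabel (w ++ [a])) w with hx
    have hqu : labelQueue (cochargeLabel (w ++ [a])) (w ++ [a]) = 0 :: x := by
      rw [labelQueue_append]
      simp [labelQueue, h0, hx]
    rw [hqu] at hou
    rw [hq, h0] at hov
    refine ⟨fun k => ?_, fun e => ?_⟩
    · have h₁ := overflow_cons_le k (Multiset.replicate n 0) 0 x
      have h₂ := hou k
      have h₃ := hov k
      omega
    -- If the types were equal, the overflows at threshold 1 would agree. They count the nonzero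
    -- labels, and the corotation has turned a label 0 into 1.
    · have h₂ := hou 1
      have h₃ := hov 1
      rw [e] at h₃
      have hlen : (0 :: x).length = n := hqu ▸ hlu.length_labelQueue
      have hc : (0 :: x).count 0 ≤ n := hlen ▸ List.count_le_length
      have hc' : (x ++ [0 + 1]).count 0 ≤ n := by simp at hc ⊢; omega
      have h₄ := overflow_one n 0 hc
      have h₅ := overflow_one n 0 hc'
      simp at h₂ h₃ h₄ h₅
      omega
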